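/- Let $\lambda=(\lambda_1\ge\dots\ge\lambda_\ell>0)$ be a partition with exactly $\ell\ge 1$ nonzero parts, and let $m$ be an integer with $m>3\ell$. Let $\mathbb{S}_\lambda$ be the Schur functor of $\lambda$ on complex vector spaces ($\mathbb{S}_\lambda(V)$ is the image of the Young symmetrizer of $\lambda$ on $V^{\otimes|\lambda|}$), and let $\mathbb{S}_\lambda(\mathrm{SL}_m)\le \mathrm{GL}(\mathbb{S}_\lambda(\mathbb{C}^m))$ be the image of $\mathrm{SL}_m(\mathbb{C})$ under the representation of $\mathrm{GL}_m(\mathbb{C})$ on $\mathbb{S}_\lambda(\mathbb{C}^m)$. Then the representation $\otimes^3$ of $\mathrm{GL}(\mathbb{S}_\lambda(\mathbb{C}^m))$ on $\mathbb{S}_\lambda(\mathbb{C}^m)^{\otimes 3}$ does not detect $\mathbb{S}_\lambda(\mathrm{SL}_m)$; that is, there is no one-dimensional subspace of $\mathbb{S}_\lambda(\mathbb{C}^m)^{\otimes 3}$ that is mapped to itself by every element of $\mathbb{S}_\lambda(\mathrm{SL}_m)$. -/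

import Mathlib

/-!
Partitions are Young diagrams in English notation: the cell `(i, j)` lies in row `i` and column `j`,
and the nonzero parts of the partition are the row lengths `lam.rowLens`.
-/

open scoped TensorProduct

noncomputable section

namespace Schur

/-- The cells (boxes) of the Young diagram, as a finite type. -/
abbrev Cell (lam : YoungDiagram) : Type := {c : ℕ × ℕ // c ∈ lam.cells}

/-- The tensor power `V^{⊗|lam|}`, with the tensor factors labelled by the boxes of `lam`. -/
abbrev CellTensor (lam : YoungDiagram) (V : Type*) [AddCommGroup V] [Module ℂ V] : Type _ :=
  ⨂[ℂ] (_ : Cell lam), V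

/-- The permutations of the boxes that preserve each row. -/
def rowGroup (lam : YoungDiagram) : Finset (Equiv.Perm (Cell lam)) :=
  Finset.univ.filter fun s => ∀ c, (s c).1.1 = c.1.1

/-- The permutations of the boxes that preserve each column. -/
def colGroup (lam : YoungDiagram) : Finset (Equiv.Perm (Cell lam)) :=
  Finset.univ.filter fun s => ∀ c, (s c).1.2 = c.1.2

section

variable (lam : YoungDiagram) (V : Type*) [AddCommGroup V] [Module ℂ V]
  {W : Type*} [AddCommGroup W] [Module ℂ W] {U : Type*} [AddCommGroup U] [Module ℂ U]

/-- The action of a permutation of the boxes on `V^{⊗|lam|}` by permuting the tensor factors. -/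
def permAct (s : Equiv.Perm (Cell lam)) : CellTensor lam V →ₗ[ℂ] CellTensor lam V :=
  (PiTensorProduct.reindex ℂ (fun _ : Cell lam => V) s).toLinearMap

/-- Row symmetrizer: the sum of all row-preserving permutations. -/
def rowSymmetrizer : CellTensor lam V →ₗ[ℂ] CellTensor lam V :=
  ∑ s ∈ rowGroup lam, permAct lam V s

/-- Column antisymmetrizer: the signed sum of all column-preserving permutations. -/
def colAntisymmetrizer : CellTensor lam V →ₗ[ℂ] CellTensor lam V :=
  ∑ s ∈ colGroup lam, ((Equiv.Perm.sign s : ℤ) : ℂ) • permAct lam V s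

/-- The action of the Young symmetrizer on `V^{⊗|lam|}`: symmetrize along the rows, then
antisymmetrize along the columns. -/
def youngSymmetrizer : CellTensor lam V →ₗ[ℂ] CellTensor lam V :=
  colAntisymmetrizer lam V ∘ₗ rowSymmetrizer lam V

/-- The Schur functor on objects: `S_lam(V)` is the image of the Young symmetrizer acting
on `V^{⊗|lam|}`. -/
def schur : Submodule ℂ (CellTensor lam V) := LinearMap.range (youngSymmetrizer lam V)

variable {V}

/-- The linear map `f^{⊗|lam|}`. -/
def tensorMap (f : V →ₗ[ℂ] W) : CellTensor lam V →ₗ[ℂ] CellTensor lam W :=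
  PiTensorProduct.map fun _ => f

theorem tensorMap_permAct (f : V →ₗ[ℂ] W) (s : Equiv.Perm (Cell lam)) (x : CellTensor lam V) :
    tensorMap lam f (permAct lam V s x) = permAct lam W s (tensorMap lam f x) :=
  PiTensorProduct.map_reindex (fun _ : Cell lam => f) s x

theorem tensorMap_youngSymmetrizer (f : V →ₗ[ℂ] W) (x : CellTensor lam V) :
    tensorMap lam f (youngSymmetrizer lam V x) = youngSymmetrizer lam W (tensorMap lam f x) := by
  simp [youngSymmetrizer, colAntisymmetrizer, rowSymmetrizer, tensorMap_permAct]

theorem tensorMap_mem (f : V →ₗ[ℂ] W) (x : CellTensor lam V) (hx : x ∈ schur lam V) :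
    tensorMap lam f x ∈ schur lam W := by
  obtain ⟨y, rfl⟩ := hx
  exact ⟨tensorMap lam f y, (tensorMap_youngSymmetrizer lam f y).symm⟩

/-- The Schur functor on linear maps: `S_lam(f)` is the restriction of `f^{⊗|lam|}`. -/
def schurMap (f : V →ₗ[ℂ] W) : schur lam V →ₗ[ℂ] schur lam W :=
  (tensorMap lam f).restrict (tensorMap_mem lam f)

theorem schurMap_id : schurMap lam (LinearMap.id : V →ₗ[ℂ] V) = LinearMap.id := by
  ext x
  simp [schurMap, tensorMap, PiTensorProduct.map_id]

theorem schurMap_comp (g : W →ₗ[ℂ] U) (f : V →ₗ[ℂ] W) :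
    schurMap lam (g ∘ₗ f) = schurMap lam g ∘ₗ schurMap lam f := by
  ext x
  simp [schurMap, tensorMap, PiTensorProduct.map_comp]

variable (V)

/-- The representation of `GL(V)` on `S_lam(V)`. -/
def schurRep : Representation ℂ (LinearMap.GeneralLinearGroup ℂ V) (schur lam V) where
  toFun g := schurMap lam (g : V →ₗ[ℂ] V)
  map_one' := schurMap_id lam
  map_mul' g h := schurMap_comp lam (g : V →ₗ[ℂ] V) (h : V →ₗ[ℂ] V)

end

/-- The subgroup `S_lam(SL_m)` of `GL(S_lam(ℂ^m))`: the image of `SL_m(ℂ) ⊆ GL(ℂ^m)` under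
the representation `S_lam`. -/
def schurSL (lam : YoungDiagram) (m : ℕ) :
    Subgroup (LinearMap.GeneralLinearGroup ℂ (schur lam (Fin m → ℂ))) :=
  ((Matrix.GeneralLinearGroup.toLin (n := Fin m) (R := ℂ)).toMonoidHom.comp
    Matrix.SpecialLinearGroup.toGL).range.map (schurRep lam (Fin m → ℂ)).asGroupHom

/-- The representation `⊗^n` of `GL(W)` on the tensor power `W^{⊗n}`. -/
def tensorPowerRep (n : ℕ) (W : Type*) [AddCommMonoid W] [Module ℂ W] :
    Representation ℂ (LinearMap.GeneralLinearGroup ℂ W) (⨂[ℂ]^n W) where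
  toFun g := PiTensorProduct.map fun _ => (g : W →ₗ[ℂ] W)
  map_one' := PiTensorProduct.map_id
  map_mul' g h := PiTensorProduct.map_comp (fun _ => (g : W →ₗ[ℂ] W)) (fun _ => (h : W →ₗ[ℂ] W))

/-- A representation `r` of `GL(W)` detects a subgroup `G` of `GL(W)` if `G` fixes a line in
the space of `r`, i.e. some one-dimensional subspace is mapped to itself by every element of `G`
(it need not be fixed pointwise). -/
def Detects {W U : Type*} [AddCommMonoid W] [Module ℂ W] [AddCommMonoid U] [Module ℂ U]
    (r : Representation ℂ (LinearMap.GeneralLinearGroup ℂ W) U)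
    (G : Subgroup (LinearMap.GeneralLinearGroup ℂ W)) : Prop :=
  ∃ L : Submodule ℂ U, Module.finrank ℂ L = 1 ∧ ∀ g ∈ G, L.map (r g) = L

end Schur

end

/-! ### Characters of SL, and a matrix in SL that doubles few vectors. -/

noncomputable section
namespace Schur

open Matrix
open Matrix.SpecialLinearGroup (diag2n diag2n_coe diagonal_transvection_induction')

variable {n : Type*} [Fintype n] [DecidableEq n]

/-! SL has no nontrivial characters, so a fixed line is spanned by an invariant vector `x`, viewed
inside the tensor power of `ℂ^m` indexed by three copies of the diagram. Write the Young symmetrizer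
as `c r`. Then `x = c y`, where `y` is symmetric along the `3ℓ` rows of the three copies. Since `c`
is Hermitian and `c² = N c` with `N` the order of the column group, `⟨x, x⟩ = ⟨c x, y⟩ = N³ ⟨x, y⟩`
(`eq_zero_of_map_tensorMap_eq`). The pairing `⟨x, y⟩` vanishes (`sum_mul_eq_zero`): evaluating `x`
with one vector per row gives an SL-invariant homogeneous polynomial of positive degree in `3ℓ < m`
vectors. Some element of SL doubles all of these vectors, so the polynomial is zero, and its
coefficients determine the pairing with row-symmetric tensors. Hence `x = 0`. -/

theorem diag2n_mul_transvection {i j : n} (hij : i ≠ j) {a : ℂ} (ha : a ≠ 0) (b : ℂ) :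
    diag2n hij a ha * SpecialLinearGroup.transvection hij b =
      SpecialLinearGroup.transvection hij (a ^ 2 * b) * diag2n hij a ha := by
  ext k l
  simp only [Matrix.SpecialLinearGroup.coe_mul, diag2n_coe, SpecialLinearGroup.transvection_coe, diagonal_mul, mul_diagonal, Matrix.add_apply, one_apply, single_apply]
  by_cases h1 : k = i <;> by_cases h2 : l = j <;> by_cases h3 : k = l <;> simp_all <;> grind

/-- The signed permutation matrix exchanging the coordinates `i` and `j`. -/
def signedSwap {i j : n} (hij : i ≠ j) : SpecialLinearGroup n ℂ :=
  ⟨(Equiv.swap i j).permMatrix ℂ * diagonal (fun k => if k = i then -1 else 1), by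
    rw [det_mul, det_permutation, det_diagonal, Equiv.Perm.sign_swap hij]
    simp⟩

theorem signedSwap_coe {i j : n} (hij : i ≠ j) : (signedSwap hij : Matrix n n ℂ) =
    (Equiv.swap i j).permMatrix ℂ * diagonal (fun k => if k = i then -1 else 1) := rfl

/-- A Weyl group element inverts the torus element, so characters agree on it and its inverse. -/
theorem signedSwap_mul_diag2n {i j : n} (hij : i ≠ j) {a : ℂ} (ha : a ≠ 0) :
    signedSwap hij * diag2n hij a ha = diag2n hij a⁻¹ (inv_ne_zero ha) * signedSwap hij := by
  ext k l
  simp only [signedSwap_coe, Matrix.SpecialLinearGroup.coe_mul,  diag2n_coe, diagonal_mul, mul_diagonal, ← mul_assoc,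
    Equiv.Perm.permMatrix, PEquiv.toMatrix_apply, Equiv.toPEquiv_apply, Option.mem_def, Option.some_inj,
    Equiv.swap_apply_def]
  by_cases h1 : k = i <;> by_cases h2 : k = j <;> by_cases h3 : l = i <;> by_cases h4 : l = j <;>
    simp_all
  all_goals grind

theorem diag2n_mul_self {i j : n} (hij : i ≠ j) {a : ℂ} (ha : a ≠ 0) :
    diag2n hij a ha * diag2n hij a ha = diag2n hij (a ^ 2) (pow_ne_zero 2 ha) := by
  ext k l
  simp only [Matrix.SpecialLinearGroup.coe_mul, diag2n_coe, diagonal_mul_diagonal, diagonal_apply]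
  grind

theorem diag2n_mul_inv {i j : n} (hij : i ≠ j) {a : ℂ} (ha : a ≠ 0) :
    diag2n hij a ha * diag2n hij a⁻¹ (inv_ne_zero ha) = 1 := by
  ext k l
  simp only [Matrix.SpecialLinearGroup.coe_mul, diag2n_coe, diagonal_mul_diagonal, diagonal_apply, Matrix.SpecialLinearGroup.coe_one, one_apply]
  grind

theorem map_specialLinearGroup_eq_one [Nontrivial n] {A : Type*} [CommGroup A]
    (χ : SpecialLinearGroup n ℂ →* A) (g : SpecialLinearGroup n ℂ) : χ g = 1 := by
  refine diagonal_transvection_induction' (fun g => χ g = 1) g ?_ ?_ ?_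
  · intro i j hij c hc
    -- With `c = a²` and `d` the element for `a`, `χ(d) = χ(d⁻¹)` gives `χ(d²) = 1`.
    obtain ⟨a, rfl⟩ := IsAlgClosed.exists_pow_nat_eq c two_pos
    have ha : a ≠ 0 := by rintro rfl; simp at hc
    have h1 := congrArg χ (signedSwap_mul_diag2n hij ha)
    have h2 := congrArg χ (diag2n_mul_inv hij ha)
    have h3 := congrArg χ (diag2n_mul_self hij ha)
    rw [map_mul, map_mul, mul_comm] at h1
    rw [map_mul, ← mul_right_cancel h1, map_one, ← map_mul, h3] at h2
    exact h2
  · intro i j hij b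
    have h2 : (2 : ℂ) ≠ 0 := two_ne_zero
    -- Conjugation multiplies the parameter by `4`, and `4 * (b / 3) = b / 3 + b`, so the
    -- transvection by `b` has trivial character.
    have h1 := congrArg χ (diag2n_mul_transvection hij h2 (b / 3))
    rw [map_mul, map_mul, mul_comm] at h1
    have h3 := mul_right_cancel h1
    rw [show (2 : ℂ) ^ 2 * (b / 3) = b / 3 + b by ring] at h3
    rw [SpecialLinearGroup.transvection_add, map_mul] at h3
    simpa using h3
  · intro A B hA hB
    simp [hA, hB]

theorem exists_character {G U : Type*} [Group G] [AddCommGroup U] [Module ℂ U]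
    (r : Representation ℂ G U) {x : U} (hx : x ≠ 0) (h : ∀ g, ∃ c : ℂ, r g x = c • x) :
    ∃ χ : G →* ℂ, ∀ g, r g x = χ g • x := by
  choose c hc using h
  refine ⟨⟨⟨c, ?_⟩, ?_⟩, hc⟩
  · refine smul_left_injective ℂ hx ?_
    simp [← hc]
  · intro g g'
    refine smul_left_injective ℂ hx ?_
    simp only [← hc, map_mul, Module.End.mul_apply]
    rw [hc g', map_smul, hc g, smul_smul, mul_comm]

theorem fixed_of_line_fixed [Nontrivial n] {U : Type*} [AddCommGroup U] [Module ℂ U]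
    (r : Representation ℂ (SpecialLinearGroup n ℂ) U) {x : U}
    (h : ∀ g, ∃ c : ℂ, r g x = c • x) (g : SpecialLinearGroup n ℂ) : r g x = x := by
  by_cases hx : x = 0
  · simp [hx]
  obtain ⟨χ, hχ⟩ := exists_character r hx h
  have h1 := congrArg Units.val (map_specialLinearGroup_eq_one χ.toHomUnits g)
  rw [hχ, show χ g = 1 from h1, one_smul]

/-- Fewer than `m` row vectors can be doubled by a matrix of determinant one. -/
theorem exists_mul_eq_two_smul {m : ℕ} {J : Type*} [Fintype J] (hJ : Fintype.card J < m)
    (t : Matrix J (Fin m) ℂ) :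
    ∃ g : SpecialLinearGroup (Fin m) ℂ, t * (g : Matrix (Fin m) (Fin m) ℂ) = (2 : ℂ) • t := by
  classical
  have hk : LinearMap.ker (Matrix.toLin' t) ≠ ⊥ :=
    LinearMap.ker_ne_bot_of_finrank_lt (by simpa using hJ)
  obtain ⟨f, hf, hf0⟩ := Submodule.exists_mem_ne_zero_of_ne_bot hk
  obtain ⟨i, hi⟩ := Function.ne_iff.mp hf0
  have htf : t *ᵥ f = 0 := by simpa using hf
  let v : Fin m → ℂ := Pi.single i (f i)⁻¹
  have hv : v ⬝ᵥ f = 1 := by simpa [v] using inv_mul_cancel₀ hi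
  -- A rank-one correction along the kernel vector `f`: `t` does not see it, and its factor `2⁻ᵐ`
  -- makes the determinant one.
  refine ⟨⟨(2 : ℂ) • (1 + vecMulVec ((((2 : ℂ) ^ m)⁻¹ - 1) • f) v), ?_⟩, ?_⟩
  · rw [det_smul, vecMulVec_eq (Fin 1), det_one_add_replicateCol_mul_replicateRow]
    simp [hv]
  · simp [Matrix.mul_add, mul_vecMulVec, htf]

end Schur
end

/-! ### Invariant tensors as polynomials in few vectors. -/

noncomputable section
namespace Schur

open Matrix

section Content

variable {I A : Type*} [Fintype I]

theorem exists_perm_comp_eq [DecidableEq A] (f g : I → A)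
    (h : ∀ a, Fintype.card {i // g i = a} = Fintype.card {i // f i = a}) :
    ∃ s : Equiv.Perm I, f ∘ s = g := by
  refine ⟨(Equiv.sigmaFiberEquiv g).symm.trans ((Equiv.sigmaCongrRight fun a =>
    Fintype.equivOfCardEq (h a)).trans (Equiv.sigmaFiberEquiv f)), ?_⟩
  ext i
  exact (Fintype.equivOfCardEq (h (g i)) ⟨i, rfl⟩).2

/-- The exponent vector of the monomial `∏ i, X (f i)`. -/
def content (f : I → A) : A →₀ ℕ := ∑ i, Finsupp.single (f i) 1

theorem content_apply [DecidableEq A] (f : I → A) (a : A) :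
    content f a = Fintype.card {i // f i = a} := by
  simp [content, Finsupp.single_apply, Fintype.card_subtype]

theorem exists_perm_of_content_eq {f g : I → A} (h : content f = content g) :
    ∃ s : Equiv.Perm I, f ∘ s = g := by
  classical
  exact exists_perm_comp_eq f g fun a => (content_apply g a).symm.trans
    ((DFunLike.congr_fun h a).symm.trans (content_apply f a))

theorem monomial_content (f : I → A) (c : ℂ) :
    MvPolynomial.monomial (content f) c = MvPolynomial.C c * ∏ i, MvPolynomial.X (f i) := by
  simp [MvPolynomial.X, content, MvPolynomial.C_mul_monomial,
    ← MvPolynomial.monomial_sum_one]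

end Content

variable {I J : Type*} [Fintype I] [DecidableEq I] {m : ℕ}

/-- The polynomial function on families of vectors indexed by `J` which a tensor `X` induces when
its factors are distributed over `J` by `ρ`. -/
def tensorEval (ρ : I → J) (X : (I → Fin m) → ℂ) (t : Matrix J (Fin m) ℂ) : ℂ :=
  ∑ w, X w * ∏ i, t (ρ i) (w i)

theorem tensorEval_mul (ρ : I → J) {X : (I → Fin m) → ℂ} {g : Matrix (Fin m) (Fin m) ℂ}
    (hX : ∀ w, ∑ w', (∏ i, g (w i) (w' i)) * X w' = X w) (t : Matrix J (Fin m) ℂ) :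
    tensorEval ρ X (t * g) = tensorEval ρ X t := by
  classical
  have h1 (w' : I → Fin m) : ∏ i, (t * g) (ρ i) (w' i) =
      ∑ w : I → Fin m, ∏ i, t (ρ i) (w i) * g (w i) (w' i) := by
    simp only [mul_apply, Finset.prod_univ_sum, Fintype.piFinset_univ]
  simp only [tensorEval, h1]
  rw [← Finset.sum_congr rfl fun w _ => congrArg (· * ∏ i, t (ρ i) (w i)) (hX w)]
  simp only [Finset.mul_sum, Finset.sum_mul, Finset.prod_mul_distrib]
  rw [Finset.sum_comm]
  exact Finset.sum_congr rfl fun _ _ => Finset.sum_congr rfl fun _ _ => by ring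

theorem tensorEval_smul (ρ : I → J) (X : (I → Fin m) → ℂ) (c : ℂ) (t : Matrix J (Fin m) ℂ) :
    tensorEval ρ X (c • t) = c ^ Fintype.card I * tensorEval ρ X t := by
  simp only [tensorEval, Matrix.smul_apply, smul_eq_mul, Finset.prod_mul_distrib, Finset.prod_const,
    Finset.mul_sum, Finset.card_univ]
  exact Finset.sum_congr rfl fun _ _ => by ring

theorem tensorEval_eq_zero [Nonempty I] [Fintype J] (hJ : Fintype.card J < m) (ρ : I → J)
    {X : (I → Fin m) → ℂ}
    (hX : ∀ (g : SpecialLinearGroup (Fin m) ℂ) (w), ∑ w', (∏ i, g (w i) (w' i)) * X w' = X w)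
    (t : Matrix J (Fin m) ℂ) : tensorEval ρ X t = 0 := by
  obtain ⟨g, hg⟩ := exists_mul_eq_two_smul hJ t
  have h := tensorEval_mul ρ (hX g) t
  rw [hg, tensorEval_smul] at h
  have h2 : (2 : ℂ) ^ Fintype.card I ≠ 1 := by
    exact_mod_cast (Nat.one_lt_two_pow Fintype.card_ne_zero).ne'
  by_contra h0
  exact h2 (mul_right_cancel₀ h0 (h.trans (one_mul _).symm))

/-- These sums are the coefficients of the polynomial `tensorEval ρ X`, which is zero because it
vanishes at every point over an infinite field. -/
theorem sum_content_eq_zero {ρ : I → J} {X : (I → Fin m) → ℂ}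
    (h : ∀ t, tensorEval ρ X t = 0) [DecidableEq (J × Fin m →₀ ℕ)] (e : J × Fin m →₀ ℕ) :
    ∑ w with content (fun i => (ρ i, w i)) = e, X w = 0 := by
  classical
  have hQ : ∑ w, MvPolynomial.monomial (content fun i => (ρ i, w i)) (X w) = 0 := by
    refine MvPolynomial.funext fun t => ?_
    simpa [monomial_content, MvPolynomial.eval_prod, tensorEval] using h (of fun j a => t (j, a))
  have h1 := congrArg (MvPolynomial.coeff e) hQ
  rw [Finset.sum_filter]
  simp only [MvPolynomial.coeff_sum, MvPolynomial.coeff_monomial, MvPolynomial.coeff_zero] at h1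
  convert h1

/-- An `SL`-invariant tensor is orthogonal to all tensors that are symmetric along the fibres of a
map onto fewer than `m` elements. -/
theorem sum_mul_eq_zero [Nonempty I] [Fintype J] (hJ : Fintype.card J < m) (ρ : I → J)
    {X Y : (I → Fin m) → ℂ}
    (hX : ∀ (g : SpecialLinearGroup (Fin m) ℂ) (w), ∑ w', (∏ i, g (w i) (w' i)) * X w' = X w)
    (hY : ∀ (s : Equiv.Perm I) (w), (∀ i, ρ (s i) = ρ i) → Y (w ∘ s) = Y w) :
    ∑ w, X w * Y w = 0 := by
  classical
  rw [← Finset.sum_fiberwise_of_maps_to (t := Finset.univ.image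
    fun w : I → Fin m => content fun i => (ρ i, w i)) (fun w hw => Finset.mem_image_of_mem _ hw)]
  refine Finset.sum_eq_zero fun e he => ?_
  obtain ⟨w₀, -, rfl⟩ := Finset.mem_image.mp he
  -- Words with equal content differ by a permutation preserving `ρ`, so `Y` is constant on each
  -- class.
  have h1 : ∀ w ∈ ({w | content (fun i => (ρ i, w i)) = content (fun i => (ρ i, w₀ i))} :
      Finset (I → Fin m)), X w * Y w = X w * Y w₀ := by
    intro w hw
    obtain ⟨s, hs⟩ := exists_perm_of_content_eq (Finset.mem_filter.mp hw).2.symm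
    rw [← hY s w₀ fun i => congrArg Prod.fst (congrFun hs i)]
    congr 2
    exact funext fun i => (congrArg Prod.snd (congrFun hs i)).symm
  rw [Finset.sum_congr rfl h1, ← Finset.sum_mul,
    sum_content_eq_zero (tensorEval_eq_zero hJ ρ hX), zero_mul]

end Schur
end

/-! ### Symmetrizers and their matrices in the standard tensor basis. -/

noncomputable section
namespace Schur

open Matrix Module

section Coordinates

variable {K κ W : Type*} [Fintype K] [DecidableEq K] [Fintype κ] [DecidableEq κ] [AddCommGroup W] [Module ℂ W]

theorem repr_piTensorProduct_map (b : Basis κ ℂ W) (A : W →ₗ[ℂ] W) (x : ⨂[ℂ] (_ : K), W)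
    (p : K → κ) :
    (Basis.piTensorProduct fun _ : K => b).repr (PiTensorProduct.map (fun _ => A) x) p =
      ∑ q : K → κ, (∏ k, LinearMap.toMatrix b b A (p k) (q k)) *
        (Basis.piTensorProduct fun _ : K => b).repr x q := by
  induction x using PiTensorProduct.induction_on with
  | smul_tprod r v =>
    have h (k : K) : b.repr (A (v k)) (p k) =
        ∑ j, LinearMap.toMatrix b b A (p k) j * b.repr (v k) j := by
      rw [← LinearMap.toMatrix_mulVec_repr b b]; rfl
    simp only [map_smul, PiTensorProduct.map_tprod, Finsupp.smul_apply,
      Basis.piTensorProduct_repr_tprod_apply, h, Finset.prod_univ_sum, Fintype.piFinset_univ,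
      Finset.prod_mul_distrib, smul_eq_mul, Finset.mul_sum]
    exact Finset.sum_congr rfl fun _ _ => by ring
  | add x y hx hy => simp [hx, hy, mul_add, Finset.sum_add_distrib]

end Coordinates

section Permutations

variable (lam : YoungDiagram) (V : Type*) [AddCommGroup V] [Module ℂ V]

theorem permAct_mul (s t : Equiv.Perm (Cell lam)) :
    permAct lam V (s * t) = permAct lam V s * permAct lam V t := by
  ext v
  simp only [permAct, LinearMap.compMultilinearMap_apply, Module.End.mul_apply,
    LinearEquiv.coe_coe, PiTensorProduct.reindex_tprod]
  rfl

variable {lam} in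
theorem mul_mem_rowGroup_iff {s : Equiv.Perm (Cell lam)} (hs : s ∈ rowGroup lam)
    (t : Equiv.Perm (Cell lam)) : s * t ∈ rowGroup lam ↔ t ∈ rowGroup lam := by
  simp only [rowGroup, Finset.mem_filter, Finset.mem_univ, true_and] at *
  simp [hs]

variable {lam} in
theorem mul_mem_colGroup_iff {s : Equiv.Perm (Cell lam)} (hs : s ∈ colGroup lam)
    (t : Equiv.Perm (Cell lam)) : s * t ∈ colGroup lam ↔ t ∈ colGroup lam := by
  simp only [colGroup, Finset.mem_filter, Finset.mem_univ, true_and] at *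
  simp [hs]

variable {lam} in
theorem inv_mem_colGroup {s : Equiv.Perm (Cell lam)} (hs : s ∈ colGroup lam) :
    s⁻¹ ∈ colGroup lam := by
  simp only [colGroup, Finset.mem_filter, Finset.mem_univ, true_and] at *
  intro c
  simpa using (hs (s⁻¹ c)).symm

variable {lam} in
theorem permAct_mul_rowSymmetrizer {s : Equiv.Perm (Cell lam)} (hs : s ∈ rowGroup lam) :
    permAct lam V s * rowSymmetrizer lam V = rowSymmetrizer lam V := by
  simp only [rowSymmetrizer, Finset.mul_sum, ← permAct_mul]
  exact Finset.sum_equiv (Equiv.mulLeft s) (fun t => (mul_mem_rowGroup_iff hs t).symm)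
    fun _ _ => rfl

variable {lam} in
theorem permAct_mul_colAntisymmetrizer {s : Equiv.Perm (Cell lam)} (hs : s ∈ colGroup lam) :
    ((Equiv.Perm.sign s : ℤ) : ℂ) • (permAct lam V s * colAntisymmetrizer lam V) =
      colAntisymmetrizer lam V := by
  simp only [colAntisymmetrizer, Finset.mul_sum, mul_smul_comm, ← permAct_mul,
    Finset.smul_sum, smul_smul]
  refine Finset.sum_equiv (Equiv.mulLeft s) (fun t => (mul_mem_colGroup_iff hs t).symm)
    fun t _ => ?_
  simp

theorem colAntisymmetrizer_mul_self :
    colAntisymmetrizer lam V * colAntisymmetrizer lam V =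
      ((colGroup lam).card : ℂ) • colAntisymmetrizer lam V := by
  conv_lhs => enter [1]; rw [colAntisymmetrizer]
  rw [Finset.sum_mul, Finset.sum_congr rfl fun s hs =>
    (smul_mul_assoc _ _ _).trans (permAct_mul_colAntisymmetrizer V hs)]
  simp [Nat.cast_smul_eq_nsmul]

end Permutations

section Matrices

variable (lam : YoungDiagram) (m : ℕ)

/-- The basis of the tensor power of `ℂ^m` consisting of tensors of standard basis vectors. -/
def cellBasis : Basis (Cell lam → Fin m) ℂ (CellTensor lam (Fin m → ℂ)) :=
  Basis.piTensorProduct fun _ => Pi.basisFun ℂ (Fin m)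

/-- The induced basis of the threefold tensor power. -/
def tripleBasis : Basis (Fin 3 → Cell lam → Fin m) ℂ (⨂[ℂ]^3 (CellTensor lam (Fin m → ℂ))) :=
  Basis.piTensorProduct fun _ => cellBasis lam m

theorem tripleBasis_repr_map (A : CellTensor lam (Fin m → ℂ) →ₗ[ℂ] CellTensor lam (Fin m → ℂ))
    (x : ⨂[ℂ]^3 (CellTensor lam (Fin m → ℂ))) (p) :
    (tripleBasis lam m).repr (PiTensorProduct.map (fun _ => A) x) p =
      ∑ q, (∏ k, LinearMap.toMatrix (cellBasis lam m) (cellBasis lam m) A (p k) (q k)) *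
        (tripleBasis lam m).repr x q :=
  repr_piTensorProduct_map _ A x p

theorem toMatrix_tensorMap (g : Matrix (Fin m) (Fin m) ℂ) (p q : Cell lam → Fin m) :
    LinearMap.toMatrix (cellBasis lam m) (cellBasis lam m) (tensorMap lam (Matrix.toLin' g)) p q =
      ∏ c, g (p c) (q c) := by
  simp [LinearMap.toMatrix_apply, cellBasis, tensorMap]

theorem cellBasis_repr_permAct (s : Equiv.Perm (Cell lam)) (x : CellTensor lam (Fin m → ℂ))
    (p : Cell lam → Fin m) :
    (cellBasis lam m).repr (permAct lam (Fin m → ℂ) s x) p = (cellBasis lam m).repr x (p ∘ s) := by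
  induction x using PiTensorProduct.induction_on with
  | smul_tprod r v =>
    simp only [permAct, cellBasis, map_smul, LinearEquiv.coe_coe, PiTensorProduct.reindex_tprod,
      Finsupp.smul_apply, Basis.piTensorProduct_repr_tprod_apply]
    congr 1
    exact (Equiv.prod_comp s _).symm.trans (by simp)
  | add x y hx hy => simp [hx, hy]

theorem toMatrix_rowSymmetrizer_comp {s : Equiv.Perm (Cell lam)} (hs : s ∈ rowGroup lam)
    (p q : Cell lam → Fin m) :
    LinearMap.toMatrix (cellBasis lam m) (cellBasis lam m) (rowSymmetrizer lam _) (p ∘ s) q =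
      LinearMap.toMatrix (cellBasis lam m) (cellBasis lam m) (rowSymmetrizer lam _) p q := by
  rw [LinearMap.toMatrix_apply, LinearMap.toMatrix_apply, ← cellBasis_repr_permAct,
    ← Module.End.mul_apply, permAct_mul_rowSymmetrizer _ hs]

theorem toMatrix_colAntisymmetrizer (p q : Cell lam → Fin m) :
    LinearMap.toMatrix (cellBasis lam m) (cellBasis lam m) (colAntisymmetrizer lam _) p q =
      ∑ s ∈ colGroup lam, ((Equiv.Perm.sign s : ℤ) : ℂ) * if q = p ∘ s then 1 else 0 := by
  simp [LinearMap.toMatrix_apply, colAntisymmetrizer, Finsupp.finsetSum_apply,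
    cellBasis_repr_permAct, Finsupp.single_apply]

/-- Permutation matrices are unitary, and inversion preserves both the column group and signs; hence
the antisymmetrizer is Hermitian. -/
theorem star_toMatrix_colAntisymmetrizer (p q : Cell lam → Fin m) :
    star (LinearMap.toMatrix (cellBasis lam m) (cellBasis lam m) (colAntisymmetrizer lam _) p q) =
      LinearMap.toMatrix (cellBasis lam m) (cellBasis lam m) (colAntisymmetrizer lam _) q p := by
  rw [toMatrix_colAntisymmetrizer, toMatrix_colAntisymmetrizer, star_sum]
  refine Finset.sum_bij' (fun s _ => s⁻¹) (fun s _ => s⁻¹) (fun _ => inv_mem_colGroup)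
    (fun _ => inv_mem_colGroup) (by simp) (by simp) fun s _ => ?_
  have h : q = p ∘ s ↔ p = q ∘ s.symm := by
    constructor <;> rintro rfl <;> ext c <;> simp
  simp only [h, star_mul', Equiv.Perm.sign_inv]
  by_cases h1 : p = q ∘ s.symm <;> simp [h1]

end Matrices

end Schur
end

/-! ### The Hermitian argument and descent to the Schur functor. -/

noncomputable section
namespace Schur

open Matrix Module

variable {lam : YoungDiagram} {m : ℕ}

theorem fst_lt_of_length_rowLens_eq {ℓ : ℕ} (h : lam.rowLens.length = ℓ) (c : Cell lam) :
    c.1.1 < ℓ := by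
  rw [← h, YoungDiagram.length_rowLens, ← YoungDiagram.mem_iff_lt_colLen]
  exact lam.up_left_mem le_rfl (Nat.zero_le _) c.2

theorem sum_repr_mul_star_repr_eq_zero {ℓ : ℕ} (hlam : lam.rowLens.length = ℓ) (hpos : 0 < ℓ)
    (hm : 3 * ℓ < m) (x z : ⨂[ℂ]^3 (CellTensor lam (Fin m → ℂ)))
    (hx : ∀ g : SpecialLinearGroup (Fin m) ℂ,
      PiTensorProduct.map (fun _ => tensorMap lam (Matrix.toLin' (g : Matrix _ _ ℂ))) x = x) :
    ∑ p, (tripleBasis lam m).repr x p * star ((tripleBasis lam m).repr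
      (PiTensorProduct.map (fun _ => rowSymmetrizer lam (Fin m → ℂ)) z) p) = 0 := by
  have : Nonempty (Fin 3 × Cell lam) := by
    refine ⟨0, ⟨(0, 0), ?_⟩⟩
    rw [← hlam, YoungDiagram.length_rowLens] at hpos
    exact YoungDiagram.mem_iff_lt_colLen.mpr hpos
  let e := Equiv.curry (Fin 3) (Cell lam) (Fin m)
  rw [← e.sum_comp]
  -- The fibres are the rows of the three copies of the diagram.
  refine sum_mul_eq_zero (J := Fin 3 × Fin ℓ) (by simpa using hm)
    (fun i => (i.1, ⟨i.2.1.1, fst_lt_of_length_rowLens_eq hlam i.2⟩)) ?_ ?_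
  · intro g w
    conv_rhs => rw [← hx g, tripleBasis_repr_map, ← e.sum_comp]
    refine Finset.sum_congr rfl fun w' _ => ?_
    simp only [toMatrix_tensorMap, Fintype.prod_prod_type]
    rfl
  · intro s w hs
    -- A permutation preserving these fibres splits into one row permutation `σ k` per copy.
    have h1 (k : Fin 3) (c : Cell lam) : s (k, c) = (k, (s (k, c)).2) :=
      Prod.ext (Prod.ext_iff.mp (hs (k, c))).1 rfl
    have hbij (k : Fin 3) : Function.Bijective fun c => (s (k, c)).2 := by
      refine Finite.injective_iff_bijective.mp fun c c' h => ?_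
      have h2 : s (k, c) = s (k, c') := by rw [h1 k c, h1 k c']; exact congrArg _ h
      exact congrArg Prod.snd (s.injective h2)
    let σ (k : Fin 3) : Equiv.Perm (Cell lam) := Equiv.ofBijective _ (hbij k)
    have hσ (k : Fin 3) : σ k ∈ rowGroup lam := by
      simp only [rowGroup, Finset.mem_filter, Finset.mem_univ, true_and]
      intro c
      exact congrArg Fin.val (Prod.ext_iff.mp (hs (k, c))).2
    have hw (k : Fin 3) : e (w ∘ s) k = e w k ∘ σ k :=
      funext fun c => congrArg w (h1 k c)
    simp only [tripleBasis_repr_map, hw, toMatrix_rowSymmetrizer_comp lam m (hσ _)]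

theorem eq_zero_of_map_tensorMap_eq {ℓ : ℕ} (hlam : lam.rowLens.length = ℓ) (hpos : 0 < ℓ)
    (hm : 3 * ℓ < m) (x z : ⨂[ℂ]^3 (CellTensor lam (Fin m → ℂ)))
    (hx : ∀ g : SpecialLinearGroup (Fin m) ℂ,
      PiTensorProduct.map (fun _ => tensorMap lam (Matrix.toLin' (g : Matrix _ _ ℂ))) x = x)
    (hz : x = PiTensorProduct.map (fun _ => youngSymmetrizer lam (Fin m → ℂ)) z) : x = 0 := by
  set y := PiTensorProduct.map (fun _ => rowSymmetrizer lam (Fin m → ℂ)) z with hy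
  have hxy : x = PiTensorProduct.map (fun _ => colAntisymmetrizer lam (Fin m → ℂ)) y := by
    rw [hz, hy, ← LinearMap.comp_apply, ← PiTensorProduct.map_comp]; rfl
  have hcx : PiTensorProduct.map (fun _ => colAntisymmetrizer lam (Fin m → ℂ)) x =
      (((colGroup lam).card : ℂ) ^ 3) • x := by
    conv_lhs => rw [hxy, ← LinearMap.comp_apply, ← PiTensorProduct.map_comp]
    rw [hxy]
    have h := (PiTensorProduct.mapMultilinear ℂ (fun _ : Fin 3 => CellTensor lam (Fin m → ℂ))
      (fun _ : Fin 3 => CellTensor lam (Fin m → ℂ))).map_smul_univ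
        (fun _ => ((colGroup lam).card : ℂ)) (fun _ => colAntisymmetrizer lam (Fin m → ℂ))
    simp only [PiTensorProduct.mapMultilinear_apply, Finset.prod_const, Finset.card_univ,
      Fintype.card_fin] at h
    rw [← LinearMap.smul_apply, ← h]
    simp only [← colAntisymmetrizer_mul_self]
    rfl
  -- `⟨x, x⟩ = ⟨x, c y⟩ = ⟨c x, y⟩`, a multiple of `⟨x, y⟩ = 0`.
  have h0 : ∑ p, (tripleBasis lam m).repr x p * star ((tripleBasis lam m).repr x p) = 0 := by
    calc _ = ∑ p, ∑ q, (tripleBasis lam m).repr x p *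
          ((∏ k, LinearMap.toMatrix (cellBasis lam m) (cellBasis lam m)
            (colAntisymmetrizer lam _) (q k) (p k)) * star ((tripleBasis lam m).repr y q)) := by
          refine Finset.sum_congr rfl fun p _ => ?_
          conv_lhs => enter [2]; rw [hxy, tripleBasis_repr_map]
          simp only [star_sum, star_mul', star_prod, star_toMatrix_colAntisymmetrizer,
            Finset.mul_sum]
      _ = ∑ q, (tripleBasis lam m).repr (PiTensorProduct.map
            (fun _ => colAntisymmetrizer lam (Fin m → ℂ)) x) q *
              star ((tripleBasis lam m).repr y q) := by
          rw [Finset.sum_comm]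
          simp only [tripleBasis_repr_map, Finset.sum_mul]
          exact Finset.sum_congr rfl fun _ _ => Finset.sum_congr rfl fun _ _ => by ring
      _ = 0 := by
          rw [hcx]
          simp only [map_smul, Finsupp.smul_apply, smul_eq_mul, mul_assoc, ← Finset.mul_sum]
          rw [sum_repr_mul_star_repr_eq_zero hlam hpos hm x z hx, mul_zero]
  open scoped ComplexOrder in
  refine (tripleBasis lam m).ext_elem fun p => ?_
  rw [Finset.sum_eq_zero_iff_of_nonneg fun p _ => mul_star_self_nonneg _] at h0
  simpa using h0 p (Finset.mem_univ p)

/-- Over a field the inclusion has a linear retraction, whose tensor power is again a retraction. -/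
theorem map_subtype_injective {W : Type*} [AddCommGroup W] [Module ℂ W] (S : Submodule ℂ W)
    (n : ℕ) : Function.Injective
      (PiTensorProduct.map (fun _ => S.subtype) : (⨂[ℂ]^n S) →ₗ[ℂ] ⨂[ℂ]^n W) := by
  obtain ⟨f, hf⟩ := S.subtype.exists_leftInverse_of_injective S.ker_subtype
  refine Function.LeftInverse.injective (g := PiTensorProduct.map fun _ => f) fun x => ?_
  rw [← LinearMap.comp_apply, ← PiTensorProduct.map_comp, hf, PiTensorProduct.map_id]
  rfl

theorem exists_map_subtype_eq_map {W : Type*} [AddCommGroup W] [Module ℂ W] (f : W →ₗ[ℂ] W)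
    {n : ℕ} (x : ⨂[ℂ]^n (LinearMap.range f)) :
    ∃ z : ⨂[ℂ]^n W, PiTensorProduct.map (fun _ => (LinearMap.range f).subtype) x =
      PiTensorProduct.map (fun _ => f) z := by
  obtain ⟨s, hs⟩ := f.rangeRestrict.exists_rightInverse_of_surjective f.range_rangeRestrict
  refine ⟨PiTensorProduct.map (fun _ => s) x, ?_⟩
  rw [← LinearMap.comp_apply, ← PiTensorProduct.map_comp]
  congr 2
  funext _
  conv_lhs => rw [← LinearMap.comp_id (LinearMap.range f).subtype, ← hs]
  rfl

theorem map_subtype_tensorPowerRep (g : LinearMap.GeneralLinearGroup ℂ (Fin m → ℂ)) (n : ℕ)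
    (x : ⨂[ℂ]^n (schur lam (Fin m → ℂ))) :
    PiTensorProduct.map (fun _ => (schur lam (Fin m → ℂ)).subtype)
      (tensorPowerRep n _ ((schurRep lam (Fin m → ℂ)).asGroupHom g) x) =
    PiTensorProduct.map (fun _ => tensorMap lam (g : (Fin m → ℂ) →ₗ[ℂ] (Fin m → ℂ)))
      (PiTensorProduct.map (fun _ => (schur lam (Fin m → ℂ)).subtype) x) := by
  change PiTensorProduct.map _ (PiTensorProduct.map _ x) = _
  rw [← LinearMap.comp_apply, ← LinearMap.comp_apply, ← PiTensorProduct.map_comp,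
    ← PiTensorProduct.map_comp]
  rfl

/-- The embedding of `SL_m(ℂ)` into the group of automorphisms of `ℂ^m`. -/
def slToGL (m : ℕ) :
    SpecialLinearGroup (Fin m) ℂ →* LinearMap.GeneralLinearGroup ℂ (Fin m → ℂ) :=
  (Matrix.GeneralLinearGroup.toLin (n := Fin m) (R := ℂ)).toMonoidHom.comp
    Matrix.SpecialLinearGroup.toGL

theorem exists_eigenvector_of_detects {W U : Type*} [AddCommMonoid W] [Module ℂ W]
    [AddCommGroup U] [Module ℂ U] {r : Representation ℂ (LinearMap.GeneralLinearGroup ℂ W) U}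
    {G : Subgroup (LinearMap.GeneralLinearGroup ℂ W)} (h : Detects r G) :
    ∃ x ≠ 0, ∀ g ∈ G, ∃ c : ℂ, r g x = c • x := by
  obtain ⟨L, hL, hfix⟩ := h
  obtain ⟨⟨x, hxL⟩, hx0, hspan⟩ := finrank_eq_one_iff'.mp hL
  refine ⟨x, fun h => hx0 (Subtype.ext h), fun g hg => ?_⟩
  have hmem : r g x ∈ L := by
    rw [← hfix g hg]
    exact Submodule.mem_map_of_mem hxL
  obtain ⟨c, hc⟩ := hspan ⟨_, hmem⟩
  exact ⟨c, (congrArg Subtype.val hc).symm⟩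

end Schur
end

theorem theorem2p1 (lam : YoungDiagram) (m ℓ : ℕ) (hlam : lam.rowLens.length = ℓ)
    (hpos : 0 < ℓ) (hm : 3 * ℓ < m) :
    ¬ Schur.Detects (Schur.tensorPowerRep 3 (Schur.schur lam (Fin m → ℂ)))
      (Schur.schurSL lam m) := by
  intro h
  obtain ⟨x, hx0, hx⟩ := Schur.exists_eigenvector_of_detects
    (U := ⨂[ℂ]^3 (Schur.schur lam (Fin m → ℂ)))
    (r := Schur.tensorPowerRep 3 (Schur.schur lam (Fin m → ℂ))) (G := Schur.schurSL lam m) h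
  have : Nontrivial (Fin m) := Fin.nontrivial_iff_two_le.mpr (by omega)
  let r := (Schur.tensorPowerRep 3 (Schur.schur lam (Fin m → ℂ))).comp
    ((Schur.schurRep lam (Fin m → ℂ)).asGroupHom.comp (Schur.slToGL m))
  have hr : ∀ g, r g x = x := Schur.fixed_of_line_fixed
    (U := ⨂[ℂ]^3 (Schur.schur lam (Fin m → ℂ))) r fun g => hx _ ⟨Schur.slToGL m g, ⟨g, rfl⟩, rfl⟩
  obtain ⟨z, hz⟩ := Schur.exists_map_subtype_eq_map (Schur.youngSymmetrizer lam (Fin m → ℂ)) x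
  have h0 := Schur.eq_zero_of_map_tensorMap_eq hlam hpos hm _ z (fun g => ?_) hz
  · refine hx0 (Schur.map_subtype_injective (Schur.schur lam (Fin m → ℂ)) 3 ?_)
    exact h0.trans (map_zero _).symm
  · have h := Schur.map_subtype_tensorPowerRep (Schur.slToGL m g) 3 x
    change PiTensorProduct.map _ (r g x) = _ at h
    rw [hr g] at h
    exact h.symm
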